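/- Let $k$ be a field and let $H$ be a Hopf algebra over $k$, with comultiplication $\Delta(h)=\sum_{(h)}h_1\otimes h_2$ and counit $\epsilon$, which is semisimple (that is, $H$ is a semisimple Artinian ring). Let $A$ be a left $H$-module algebra, i.e. an associative unital $k$-algebra with a $k$-linear left $H$-module structure such that $h\cdot(ab)=\sum_{(h)}(h_1\cdot a)(h_2\cdot b)$ and $h\cdot 1_A=\epsilon(h)1_A$ for all $h\in H$ and $a,b\in A$. Let $A\# H$ be the smash product, i.e. the $k$-algebra with underlying space $A\otimes_k H$, multiplication $$(a\# h)(b\# g)=\sum_{(h)} a(h_1\cdot b)\# h_2g$$ and identity $1_A\# 1_H$. 1. If $A$ is von Neumann regular (for every $a\in A$ there is $x\in A$ with $axa=a$), then $A\# H$ is von Neumann regular. 2. If $A$ is semisimple Artinian, then $A\# H$ is semisimple Artinian. -/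

import Mathlib

open scoped TensorProduct

/-- A (not necessarily commutative) ring `R` is von Neumann regular if every `a : R` is of the form
`a * x * a`. -/
def IsVonNeumannRegularRing (R : Type*) [Ring R] : Prop :=
  ∀ a : R, ∃ x : R, a * x * a = a

/-- The action `h ↦ (a ↦ h • a)` of a `k`-algebra `H` on a (`k`-linear) left `H`-module `A`. -/
def hopfAct (k H A : Type*) [Field k] [Ring H] [Algebra k H] [Ring A] [Algebra k A]
    [Module H A] [IsScalarTower k H A] : H →ₐ[k] Module.End k A :=
  Algebra.lsmul k k A

/-- A `k`-algebra `A` which is also a (`k`-linear) left `H`-module is a left `H`-module algebra if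
`h • (a * b) = ∑ (h₁ • a) * (h₂ • b)` and `h • 1 = ε(h) 1`. -/
class HopfModuleAlgebra (k H A : Type*) [Field k] [Ring H] [Bialgebra k H] [Ring A] [Algebra k A]
    [Module H A] [IsScalarTower k H A] : Prop where
  smul_mul_eq : ∀ (h : H) (a b : A), h • (a * b) =
    LinearMap.mul' k A (TensorProduct.map ((hopfAct k H A).toLinearMap.flip a)
      ((hopfAct k H A).toLinearMap.flip b) (Coalgebra.comul (R := k) h))
  smul_one_eq : ∀ h : H, h • (1 : A) = algebraMap k A (Coalgebra.counit (R := k) h)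

/-- The underlying type of the smash product `A # H`: the tensor product `A ⊗ H` over `k`.
(Its multiplication, defined below, is not that of the tensor product of algebras.) -/
def SmashProduct (k A H : Type*) [Field k] [Ring A] [Algebra k A] [Ring H] [Algebra k H] : Type _ :=
  A ⊗[k] H

namespace SmashProduct

section Construction

variable (k A H : Type*) [Field k] [Ring H] [Bialgebra k H] [Ring A] [Algebra k A]

noncomputable instance : AddCommGroup (SmashProduct k A H) :=
  inferInstanceAs (AddCommGroup (A ⊗[k] H))

noncomputable instance : Module k (SmashProduct k A H) :=
  inferInstanceAs (Module k (A ⊗[k] H))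

variable {A H}

/-- The element `a # h`, that is, the pure tensor `a ⊗ h`. -/
def tmul (a : A) (h : H) : SmashProduct k A H := a ⊗ₜ[k] h

variable (A H)

/-- Left multiplication by `a : A` on the first factor of `A ⊗ H`. -/
noncomputable def leftA : A →ₗ[k] Module.End k (A ⊗[k] H) :=
  (LinearMap.rTensorHom H).comp (LinearMap.mul k A)

variable {k A H} in
theorem leftA_tmul (a b : A) (g : H) :
    leftA k A H a (b ⊗ₜ[k] g) = (a * b) ⊗ₜ[k] g := rfl

variable {k A H} in
theorem leftA_mul (a b : A) : leftA k A H (a * b) = leftA k A H a * leftA k A H b := by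
  ext c d
  simp [leftA_tmul, mul_assoc]

variable [Module H A] [IsScalarTower k H A]

/-- The diagonal action `h · (b ⊗ g) = ∑ (h₁ • b) ⊗ (h₂ * g)` of `H` on `A ⊗ H`. -/
noncomputable def diag : H →ₐ[k] Module.End k (A ⊗[k] H) :=
  ((Module.endTensorEndAlgHom (R := k) (S := k) (A := k) (M := A) (N := H)).comp
    (Algebra.TensorProduct.map (hopfAct k H A) (Algebra.lmul k H))).comp
    (Bialgebra.comulAlgHom k H)

/-- The multiplication of the smash product as a bilinear map on `A ⊗ H`:
`(a ⊗ h, b ⊗ g) ↦ ∑ (a * (h₁ • b)) ⊗ (h₂ * g)`. -/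
noncomputable def mulMap : A ⊗[k] H →ₗ[k] Module.End k (A ⊗[k] H) :=
  TensorProduct.lift ((LinearMap.mul k (Module.End k (A ⊗[k] H))).compl₁₂ (leftA k A H)
    (diag k A H).toLinearMap)

variable {k A H}

theorem mulMap_tmul (a : A) (h : H) :
    mulMap k A H (a ⊗ₜ[k] h) = leftA k A H a * diag k A H h := rfl

theorem diag_tmul {h : H} {ι : Type*} (r : Coalgebra.Repr k h ι) (b : A) (g : H) :
    diag k A H h (b ⊗ₜ[k] g) =
      ∑ i ∈ r.index, (r.left i • b) ⊗ₜ[k] (r.right i * g) := by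
  simp only [diag, AlgHom.comp_apply, Bialgebra.comulAlgHom_apply, ← r.eq, map_sum,
    LinearMap.sum_apply]
  rfl

theorem mulMap_leftA (a : A) (x : A ⊗[k] H) :
    mulMap k A H (leftA k A H a x) = leftA k A H a * mulMap k A H x := by
  induction x using TensorProduct.induction_on with
  | zero => simp
  | tmul b g => rw [leftA_tmul, mulMap_tmul, mulMap_tmul, leftA_mul, mul_assoc]
  | add x y hx hy => simp [hx, hy, mul_add]

theorem mulMap_one (x : A ⊗[k] H) : mulMap k A H (1 ⊗ₜ[k] 1) x = x := by
  have : leftA k A H (1 : A) = 1 := by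
    ext c d
    simp [leftA_tmul]
  rw [mulMap_tmul, map_one (diag k A H), this, one_mul, Module.End.one_apply]

variable [HopfModuleAlgebra k H A]

/-- `∑ (h₁ • b) · (h₂ · x) = h · (b x)` for the diagonal action on `A ⊗ H`. -/
theorem sum_leftA_diag {h : H} {ι : Type*} (r : Coalgebra.Repr k h ι) (b : A) :
    ∑ i ∈ r.index, leftA k A H (r.left i • b) * diag k A H (r.right i) =
      diag k A H h * leftA k A H b := by
  ext c d
  simp only [TensorProduct.AlgebraTensorModule.curry_apply, TensorProduct.curry_apply,
    LinearMap.coe_restrictScalars, LinearMap.sum_apply, Module.End.mul_apply, leftA_tmul]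
  -- the trilinear map `x ⊗ (y ⊗ z) ↦ ((x • b) * (y • c)) ⊗ (z * d)`
  let F : H ⊗[k] (H ⊗[k] H) →ₗ[k] A ⊗[k] H :=
    (LinearMap.rTensor H (LinearMap.mul' k A)).comp
      ((TensorProduct.assoc k A A H).symm.toLinearMap.comp
        (TensorProduct.map ((hopfAct k H A).toLinearMap.flip b)
          (TensorProduct.map ((hopfAct k H A).toLinearMap.flip c) (LinearMap.mulRight k d))))
  have key := congrArg F (Coalgebra.sum_tmul_tmul_eq r
    (fun i => Coalgebra.Repr.arbitrary k (r.left i))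
    (fun i => Coalgebra.Repr.arbitrary k (r.right i)))
  have hF : ∀ x y z : H, F (x ⊗ₜ[k] (y ⊗ₜ[k] z)) = ((x • b) * (y • c)) ⊗ₜ[k] (z * d) :=
    fun x y z => rfl
  simp only [map_sum, hF] at key
  rw [diag_tmul r]
  have e1 : ∀ i, ((r.left i) • (b * c)) ⊗ₜ[k] (r.right i * d) =
      ∑ j ∈ (Coalgebra.Repr.arbitrary k (r.left i)).index,
        (((Coalgebra.Repr.arbitrary k (r.left i)).left j • b) *
          ((Coalgebra.Repr.arbitrary k (r.left i)).right j • c)) ⊗ₜ[k] (r.right i * d) := by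
    intro i
    rw [HopfModuleAlgebra.smul_mul_eq (k := k)]
    conv_lhs => rw [← (Coalgebra.Repr.arbitrary k (r.left i)).eq]
    rw [map_sum, map_sum, TensorProduct.sum_tmul]
    rfl
  have e2 : ∀ i, leftA k A H (r.left i • b) (diag k A H (r.right i) (c ⊗ₜ[k] d)) =
      ∑ j ∈ (Coalgebra.Repr.arbitrary k (r.right i)).index,
        ((r.left i • b) * ((Coalgebra.Repr.arbitrary k (r.right i)).left j • c)) ⊗ₜ[k]
          ((Coalgebra.Repr.arbitrary k (r.right i)).right j * d) := by
    intro i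
    rw [diag_tmul (Coalgebra.Repr.arbitrary k (r.right i)), map_sum]
    rfl
  simp only [e1, e2]
  exact key.symm

theorem mulMap_diag (h : H) (x : A ⊗[k] H) :
    mulMap k A H (diag k A H h x) = diag k A H h * mulMap k A H x := by
  induction x using TensorProduct.induction_on with
  | zero => simp
  | tmul b g =>
    let r := Coalgebra.Repr.arbitrary k h
    rw [diag_tmul r, map_sum, mulMap_tmul, ← mul_assoc, ← sum_leftA_diag r, Finset.sum_mul]
    simp only [mulMap_tmul, map_mul, mul_assoc]
  | add x y hx hy => simp [hx, hy, mul_add]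

theorem mulMap_mulMap (x y : A ⊗[k] H) :
    mulMap k A H (mulMap k A H x y) = mulMap k A H x * mulMap k A H y := by
  induction x using TensorProduct.induction_on with
  | zero => simp
  | tmul a h => rw [mulMap_tmul, Module.End.mul_apply, mulMap_leftA, mulMap_diag, mul_assoc]
  | add x y hx hy => simp [hx, hy, add_mul]

theorem mulMap_apply_one (x : A ⊗[k] H) : mulMap k A H x (1 ⊗ₜ[k] 1) = x := by
  induction x using TensorProduct.induction_on with
  | zero => simp
  | tmul a h =>
    let r := Coalgebra.Repr.arbitrary k h
    rw [mulMap_tmul, Module.End.mul_apply, diag_tmul r]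
    simp only [HopfModuleAlgebra.smul_one_eq (k := k), mul_one, Algebra.algebraMap_eq_smul_one,
      TensorProduct.smul_tmul]
    rw [← TensorProduct.tmul_sum, Coalgebra.sum_counit_smul, leftA_tmul, mul_one]
  | add x y hx hy => simp [hx, hy]

/-- The ring structure of the smash product `A # H`. -/
noncomputable instance : Ring (SmashProduct k A H) :=
  { (inferInstance : AddCommGroup (SmashProduct k A H)) with
    mul := fun x y => mulMap k A H x y
    one := tmul k 1 1
    mul_assoc := fun x y z => LinearMap.congr_fun (mulMap_mulMap x y) z
    one_mul := fun x => mulMap_one x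
    mul_one := fun x => mulMap_apply_one x
    left_distrib := fun x y z => map_add (mulMap k A H x) y z
    right_distrib := fun x y z => LinearMap.congr_fun (map_add (mulMap k A H) x y) z
    zero_mul := fun x => LinearMap.congr_fun (map_zero (mulMap k A H)) x
    mul_zero := fun x => map_zero (mulMap k A H x) }

/-- The smash product `A # H` is a `k`-algebra. -/
noncomputable instance : Algebra k (SmashProduct k A H) :=
  Algebra.ofModule (fun c x y => LinearMap.congr_fun (map_smul (mulMap k A H) c x) y)
    (fun c x y => map_smul (mulMap k A H x) c y)

/-- The identity element of `A # H` is `1 # 1`. -/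
theorem one_def : (1 : SmashProduct k A H) = tmul k 1 1 := rfl

/-- The multiplication of the smash product: `(a # h)(b # g) = ∑ a (h₁ • b) # h₂ g`. -/
theorem tmul_mul_tmul (a b : A) {h : H} (g : H) {ι : Type*} (r : Coalgebra.Repr k h ι) :
    tmul k a h * tmul k b g =
      ∑ i ∈ r.index, tmul k (a * (r.left i • b)) (r.right i * g) := by
  change mulMap k A H (a ⊗ₜ[k] h) (b ⊗ₜ[k] g) = _
  rw [mulMap_tmul, Module.End.mul_apply, diag_tmul r, map_sum]
  rfl

end Construction

end SmashProduct

open TensorProduct Coalgebra HopfAlgebra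

/-! Write B = A # H. The proof is a Maschke argument: a left ideal of B that is a direct summand
over A is one over B (`SmashProduct.exists_projection`). A semisimple H has a right integral t with
ε(t) = 1, and ∑ S(t₁) ⊗ t₂ is then a Casimir element (`tmul_one_mul_antipodeComul`). Averaging an
A-linear projection p to ∑ S(t₁) p t₂ keeps it A-linear (`leftA_mul_sandwich`), makes it H-linear by
the Casimir identity, and keeps it a projection because ∑ S(t₁) t₂ = ε(t) = 1. Only the antipode
itself occurs, never its inverse. If A is semisimple, every left ideal of B splits over A, hence
over B. If A is regular, only principal left ideals need to split. The Casimir element forces H to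
be finite-dimensional, so B is free of finite rank over A. Such a module is regular, and finitely
generated submodules of regular modules split. -/

/-! ### Regular modules -/

/-- A left `R`-module `M` is (Zelmanowitz) regular if every `m : M` satisfies `f m • m = m` for some
linear functional `f`. -/
def IsRegularModule (R M : Type*) [Ring R] [AddCommGroup M] [Module R M] : Prop :=
  ∀ m : M, ∃ f : M →ₗ[R] R, f m • m = m

namespace IsRegularModule

variable {R M N : Type*} [Ring R] [AddCommGroup M] [Module R M] [AddCommGroup N] [Module R N]

theorem of_injective (hN : IsRegularModule R N) (i : M →ₗ[R] N) (hi : Function.Injective i) :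
    IsRegularModule R M := fun m => by
  obtain ⟨f, hf⟩ := hN (i m)
  exact ⟨f.comp i, hi (by rw [map_smul]; exact hf)⟩

theorem self (hR : IsVonNeumannRegularRing R) : IsRegularModule R R := fun a => by
  obtain ⟨x, hx⟩ := hR a
  exact ⟨LinearMap.toSpanSingleton R R x, hx⟩

theorem prod (hM : IsRegularModule R M) (hN : IsRegularModule R N) :
    IsRegularModule R (M × N) := by
  rintro ⟨m, n⟩
  obtain ⟨f, hf⟩ := hM m
  obtain ⟨g, hg⟩ := hN (n - f m • n)
  -- With n' = c • n, the functional (x, y) ↦ f x + (g y - f x * g n) * c takes the value f m + g n'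
  -- * c at (m, n). Since c kills m and g n' • n' = n', this value fixes both m and n.
  let c : R := 1 - f m
  refine ⟨f.comp (LinearMap.fst R M N) + (LinearMap.toSpanSingleton R R c).comp
    (g.comp (LinearMap.snd R M N) -
      (LinearMap.toSpanSingleton R R (g n)).comp (f.comp (LinearMap.fst R M N))), ?_⟩
  have hc : c • m = 0 := by simp [c, sub_smul, hf]
  have hcn : c • n = n - f m • n := by simp [c, sub_smul]
  have hg' : (g n - f m * g n) • c • n = n - f m • n := by
    rw [hcn, ← smul_eq_mul, ← map_smul, ← map_sub, hg]
  ext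
  · simp [add_smul, mul_smul, hc, hf]
  · simp [add_smul, mul_smul, hg']

theorem pi_fin (hR : IsVonNeumannRegularRing R) : ∀ n : ℕ, IsRegularModule R (Fin n → R)
  | 0 => fun _ => ⟨0, Subsingleton.elim _ _⟩
  | n + 1 => ((self hR).prod (pi_fin hR n)).of_injective
      (Fin.consLinearEquiv R (fun _ : Fin (n + 1) => R)).symm.toLinearMap
      (LinearEquiv.injective _)

/-- A finitely generated submodule of a regular module is a direct summand. -/
theorem exists_projection (hM : IsRegularModule R M) {W : Submodule R M} (hW : W.FG) :
    ∃ p : M →ₗ[R] M, (∀ x, p x ∈ W) ∧ ∀ x ∈ W, p x = x := by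
  classical
  obtain ⟨s, rfl⟩ := hW
  induction s using Finset.induction_on with
  | empty => exact ⟨0, by simp, by simp +contextual⟩
  | insert m s _ ih =>
    obtain ⟨q, hq, hq'⟩ := ih
    obtain ⟨f, hf⟩ := hM (m - q m)
    have hle : Submodule.span R (s : Set M) ≤ Submodule.span R ((insert m s : Finset M) : Set M) :=
      Submodule.span_mono (by simp)
    have hm : m ∈ Submodule.span R ((insert m s : Finset M) : Set M) :=
      Submodule.subset_span (by simp)
    -- Correct q by a rank-one map through 1 - q: on a • m + y with y in the old span, 1 - q leaves
    -- a • (m - q m), which the new term reproduces.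
    refine ⟨q + (LinearMap.toSpanSingleton R M (m - q m)).comp (f.comp (LinearMap.id - q)),
      fun x => ?_, fun x hx => ?_⟩
    · exact Submodule.add_mem _ (hle (hq x))
        (Submodule.smul_mem _ _ (Submodule.sub_mem _ hm (hle (hq m))))
    · rw [Finset.coe_insert, Submodule.mem_span_insert] at hx
      obtain ⟨a, y, hy, rfl⟩ := hx
      have hy' := hq' y hy
      simp only [LinearMap.add_apply, LinearMap.comp_apply, LinearMap.sub_apply, LinearMap.id_apply,
        LinearMap.toSpanSingleton_apply, map_add, map_smul, hy', hf, sub_self, map_zero]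
      simp

end IsRegularModule

/-! ### Integrals and the Casimir element of a semisimple Hopf algebra -/

/-- A semisimple augmented algebra has a normalized left integral. -/
theorem exists_left_integral {k R : Type*} [Field k] [Ring R] [Algebra k R] [IsSemisimpleRing R]
    (ε : R →ₐ[k] k) : ∃ t : R, ε t = 1 ∧ ∀ h : R, h * t = ε h • t := by
  -- The integral is the component of 1 in a left ideal J complementary to ker ε: (h - ε(h)) t lies
  -- in both ker ε and J.
  obtain ⟨J, hJ⟩ := exists_isCompl (RingHom.ker ε : Ideal R)
  have h1 : (1 : R) ∈ (RingHom.ker ε : Ideal R) ⊔ J := hJ.sup_eq_top ▸ Submodule.mem_top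
  obtain ⟨u, hu, t, ht, hut⟩ := Submodule.mem_sup.1 h1
  have hεt : ε t = 1 := by
    have := congrArg ε hut
    rwa [map_add, map_one, (RingHom.mem_ker).1 hu, zero_add] at this
  refine ⟨t, hεt, fun h => ?_⟩
  have hk : (h - algebraMap k R (ε h)) * t ∈ (RingHom.ker ε : Ideal R) ⊓ J :=
    ⟨by simp [RingHom.mem_ker], J.mul_mem_left _ ht⟩
  rw [hJ.inf_eq_bot, Submodule.mem_bot, sub_mul, sub_eq_zero] at hk
  rw [hk, Algebra.smul_def]

section Casimir

variable (k : Type*) {H : Type*} [Field k] [Ring H] [HopfAlgebra k H]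

variable (H) in
/-- A semisimple Hopf algebra has a normalized right integral. -/
theorem exists_right_integral [IsSemisimpleRing H] :
    ∃ t : H, counit (R := k) t = 1 ∧ ∀ h : H, t * h = counit (R := k) h • t := by
  obtain ⟨t, ht, ht'⟩ := exists_left_integral
    ((Bialgebra.counitAlgHom k H).fromOpposite fun _ _ => Commute.all _ _ : Hᵐᵒᵖ →ₐ[k] k)
  exact ⟨t.unop, ht, fun h => congrArg MulOpposite.unop (ht' (MulOpposite.op h))⟩

/-- The element `∑ S(h₁) ⊗ h₂`. -/
noncomputable def antipodeComul : H →ₗ[k] H ⊗[k] H :=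
  ((antipode k (A := H)).rTensor H).comp comul

variable {k}

theorem antipodeComul_eq {h : H} {ι : Type*} (r : Coalgebra.Repr k h ι) :
    antipodeComul k h = ∑ i ∈ r.index, antipode k (r.left i) ⊗ₜ[k] r.right i := by
  rw [antipodeComul, LinearMap.comp_apply, ← r.eq, map_sum]
  rfl

/-- Since S reverses products, the factors coming from h end up on the two outer sides. -/
theorem antipodeComul_mul (x : H) {h : H} {ι : Type*} (r : Coalgebra.Repr k h ι) :
    antipodeComul k (x * h) = ∑ i ∈ r.index,
      (antipode k (r.left i) ⊗ₜ[k] 1) * antipodeComul k x * ((1 : H) ⊗ₜ[k] r.right i) := by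
  let s := Coalgebra.Repr.arbitrary k x
  rw [antipodeComul_eq s, antipodeComul, LinearMap.comp_apply, Bialgebra.comul_mul, ← r.eq, ← s.eq]
  simp only [Finset.mul_sum, Finset.sum_mul, map_sum,
    Algebra.TensorProduct.tmul_mul_tmul, LinearMap.rTensor_tmul, antipode_mul_antidistrib, one_mul,
    mul_one]

theorem mul'_antipodeComul (h : H) :
    LinearMap.mul' k H (antipodeComul k h) = algebraMap k H (counit h) :=
  mul_antipode_rTensor_comul_apply h

theorem sum_right_counit_smul {C ι : Type*} [AddCommGroup C] [Module k C] [Coalgebra k C] {h : C}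
    (r : Coalgebra.Repr k h ι) : ∑ i ∈ r.index, counit (R := k) (r.right i) • r.left i = h := by
  have := congrArg (TensorProduct.rid k C) (Coalgebra.sum_tmul_counit_eq r)
  simpa only [map_sum, TensorProduct.rid_tmul, one_smul] using this

/-- For a right integral `t`, the element `∑ S(t₁) ⊗ t₂` is a Casimir element. -/
theorem tmul_one_mul_antipodeComul {t : H} (ht : ∀ h : H, t * h = counit (R := k) h • t) (h : H) :
    (h ⊗ₜ[k] 1) * antipodeComul k t = antipodeComul k t * (1 ⊗ₜ[k] h) := by
  let r := Coalgebra.Repr.arbitrary k h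
  -- F sends x ⊗ y ⊗ z to x S(y) S(t₁) ⊗ t₂ z and is evaluated on h₁ ⊗ h₂ ⊗ h₃. Collapsing h₁ S(h₂)
  -- gives the right side; recognising `antipodeComul` of t h₂ = ε(h₂) t gives the left side.
  let F : H ⊗[k] (H ⊗[k] H) →ₗ[k] H ⊗[k] H :=
    TensorProduct.lift ((LinearMap.mul k (H ⊗[k] H)).compl₁₂
      (Algebra.TensorProduct.includeLeft : H →ₐ[k] H ⊗[k] H).toLinearMap
      (TensorProduct.lift ((LinearMap.mul k (H ⊗[k] H)).compl₁₂
        ((LinearMap.mulRight k (antipodeComul k t)).comp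
          ((Algebra.TensorProduct.includeLeft : H →ₐ[k] H ⊗[k] H).toLinearMap.comp (antipode k)))
        (Algebra.TensorProduct.includeRight : H →ₐ[k] H ⊗[k] H).toLinearMap)))
  have hF : ∀ x y z : H, F (x ⊗ₜ[k] (y ⊗ₜ[k] z)) = (x ⊗ₜ[k] 1) *
      ((antipode k y ⊗ₜ[k] 1) * antipodeComul k t * (1 ⊗ₜ[k] z)) := fun _ _ _ => rfl
  have key := congrArg F (Coalgebra.sum_tmul_tmul_eq r
    (fun i => Coalgebra.Repr.arbitrary k (r.left i))
    (fun i => Coalgebra.Repr.arbitrary k (r.right i)))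
  simp only [map_sum, hF, ← Finset.mul_sum, ← antipodeComul_mul, ht, map_smul] at key
  have e1 : ∀ i, ∑ j ∈ (Coalgebra.Repr.arbitrary k (r.left i)).index,
      ((Coalgebra.Repr.arbitrary k (r.left i)).left j ⊗ₜ[k] (1 : H)) *
        ((antipode k ((Coalgebra.Repr.arbitrary k (r.left i)).right j) ⊗ₜ[k] 1) *
          antipodeComul k t * (1 ⊗ₜ[k] r.right i)) =
      antipodeComul k t * (1 ⊗ₜ[k] (counit (R := k) (r.left i) • r.right i)) := by
    intro i
    simp only [← mul_assoc, ← Finset.sum_mul, Algebra.TensorProduct.tmul_mul_tmul, mul_one,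
      ← TensorProduct.sum_tmul, sum_mul_antipode_eq_smul]
    rw [← TensorProduct.smul_tmul', ← Algebra.TensorProduct.one_def, smul_one_mul,
      TensorProduct.tmul_smul, smul_mul_assoc, mul_smul_comm]
  simp only [e1, ← Finset.mul_sum, ← TensorProduct.tmul_sum, Coalgebra.sum_counit_smul] at key
  rw [key]
  simp only [mul_smul_comm, ← smul_mul_assoc, ← Finset.sum_mul, TensorProduct.smul_tmul',
    ← TensorProduct.sum_tmul]
  congr 2
  exact (sum_right_counit_smul r).symm

/-- An algebra over a field with a normalized Casimir element is finite-dimensional. -/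
theorem finite_of_casimir {R : Type*} [Ring R] [Algebra k R] (e : R ⊗[k] R)
    (he : ∀ h : R, (h ⊗ₜ[k] 1) * e = e * (1 ⊗ₜ[k] h)) (he1 : LinearMap.mul' k R e = 1) :
    Module.Finite k R := by
  obtain ⟨s, rfl⟩ := TensorProduct.exists_finset e
  classical
  let X : Submodule k R := Submodule.span k (s.image Prod.fst)
  let Y : Submodule k R := Submodule.span k (s.image Prod.snd)
  -- For e = ∑ xᵢ ⊗ yᵢ and a k-linear projection π onto X, applying π ⊗ 1 and multiplying turns the
  -- Casimir identity into ∑ π(h xᵢ) yᵢ = ∑ xᵢ yᵢ h = h. Hence R = X * Y.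
  obtain ⟨π, hπ⟩ := X.subtype.exists_leftInverse_of_injective X.ker_subtype
  have hX : ∀ i ∈ s, (π i.1 : R) = i.1 := fun i hi =>
    congrArg Subtype.val (LinearMap.congr_fun hπ
      ⟨i.1, Submodule.subset_span (Finset.mem_image_of_mem _ hi)⟩)
  have hY : ∀ i ∈ s, i.2 ∈ Y := fun i hi => Submodule.subset_span (Finset.mem_image_of_mem _ hi)
  refine ⟨(?_ : X * Y = ⊤) ▸ (Submodule.fg_span (Finset.finite_toSet _)).mul
    (Submodule.fg_span (Finset.finite_toSet _))⟩
  refine eq_top_iff.2 fun h _ => ?_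
  have key := congrArg (LinearMap.mul' k R ∘ ((X.subtype.comp π).rTensor R)) (he h)
  simp only [Finset.mul_sum, Finset.sum_mul, Algebra.TensorProduct.tmul_mul_tmul, one_mul, mul_one,
    map_sum, Function.comp_apply, LinearMap.rTensor_tmul, LinearMap.mul'_apply,
    LinearMap.comp_apply, Submodule.subtype_apply] at key he1
  have : h = ∑ i ∈ s, (π (h * i.1) : R) * i.2 := by
    rw [key]
    conv_lhs => rw [← one_mul h, ← he1, Finset.sum_mul]
    exact Finset.sum_congr rfl fun i hi => by rw [hX i hi, mul_assoc]
  rw [this]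
  exact Submodule.sum_mem _ fun i hi => Submodule.mul_mem_mul (π _).2 (hY i hi)

variable (k H) in
/-- A semisimple Hopf algebra is finite-dimensional. -/
theorem HopfAlgebra.finite_of_isSemisimpleRing [IsSemisimpleRing H] : Module.Finite k H := by
  obtain ⟨t, ht, ht'⟩ := exists_right_integral k H
  exact finite_of_casimir (antipodeComul k t) (tmul_one_mul_antipodeComul ht')
    (by rw [mul'_antipodeComul, ht, map_one])

end Casimir

/-! ### Averaging over the integral -/

section Average

variable {k H E : Type*} [Field k] [Ring H] [HopfAlgebra k H] [Ring E] [Algebra k E]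

/-- The linear map `x ⊗ y ↦ D x * p * D y`. -/
noncomputable def sandwich (D : H →ₐ[k] E) (p : E) : H ⊗[k] H →ₗ[k] E :=
  TensorProduct.lift ((LinearMap.mul k E).compl₁₂
    ((LinearMap.mulRight k p).comp D.toLinearMap) D.toLinearMap)

theorem sandwich_tmul (D : H →ₐ[k] E) (p : E) (x y : H) :
    sandwich D p (x ⊗ₜ[k] y) = D x * p * D y := rfl

theorem sandwich_tmul_one_mul (D : H →ₐ[k] E) (p : E) (h : H) (z : H ⊗[k] H) :
    sandwich D p ((h ⊗ₜ[k] 1) * z) = D h * sandwich D p z := by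
  induction z using TensorProduct.induction_on with
  | zero => simp
  | tmul x y => simp [sandwich_tmul, mul_assoc]
  | add x y hx hy => simp [mul_add, hx, hy]

theorem sandwich_mul_one_tmul (D : H →ₐ[k] E) (p : E) (h : H) (z : H ⊗[k] H) :
    sandwich D p (z * (1 ⊗ₜ[k] h)) = sandwich D p z * D h := by
  induction z using TensorProduct.induction_on with
  | zero => simp
  | tmul x y => simp [sandwich_tmul, mul_assoc]
  | add x y hx hy => simp [add_mul, hx, hy]

end Average

/-- Extending scalars from a field to a von Neumann regular algebra gives a regular module. -/
theorem IsRegularModule.tensorProduct {k A : Type*} (V : Type*) [Field k] [Ring A] [Algebra k A]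
    [AddCommGroup V] [Module k V] [Module.Finite k V] (hA : IsVonNeumannRegularRing A) :
    IsRegularModule A (A ⊗[k] V) := by
  let e : A ⊗[k] V ≃ₗ[A] (Fin (Module.finrank k V) → A) :=
    ((TensorProduct.AlgebraTensorModule.congr (LinearEquiv.refl A A)
      (Module.finBasis k V).repr).trans (TensorProduct.finsuppScalarRight k A A _)).trans
      (Finsupp.linearEquivFunOnFinite A A _)
  exact (IsRegularModule.pi_fin hA _).of_injective e.toLinearMap e.injective

/-! ### Maschke's theorem for the smash product -/

namespace SmashProduct

variable {k H A : Type*} [Field k] [Ring H] [HopfAlgebra k H] [Ring A] [Algebra k A]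
  [Module H A] [IsScalarTower k H A] [HopfModuleAlgebra k H A]

/-- `L(h • a) = ∑ D(h₁) L(a) D(S(h₂))`, where `L` and `D` are the actions of `A` and `H`. -/
theorem leftA_smul {h : H} {ι : Type*} (r : Coalgebra.Repr k h ι) (a : A) :
    leftA k A H (h • a) = ∑ i ∈ r.index,
      diag k A H (r.left i) * leftA k A H a * diag k A H (antipode k (r.right i)) := by
  -- Two readings of ∑ L(h₁ • a) D(h₂ S(h₃)): either h₂ S(h₃) collapses, or `sum_leftA_diag` applies
  -- to h₁, h₂.
  let F : H ⊗[k] (H ⊗[k] H) →ₗ[k] Module.End k (A ⊗[k] H) :=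
    TensorProduct.lift ((LinearMap.mul k _).compl₁₂
      ((leftA k A H).comp ((hopfAct k H A).toLinearMap.flip a))
      ((diag k A H).toLinearMap.comp
        ((LinearMap.mul' k H).comp ((antipode k (A := H)).lTensor H))))
  have hF : ∀ x y z : H, F (x ⊗ₜ[k] (y ⊗ₜ[k] z)) =
      leftA k A H (x • a) * diag k A H (y * antipode k z) := fun _ _ _ => rfl
  have key := congrArg F (Coalgebra.sum_tmul_tmul_eq r
    (fun i => Coalgebra.Repr.arbitrary k (r.left i))
    (fun i => Coalgebra.Repr.arbitrary k (r.right i)))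
  simp only [map_sum, hF] at key
  simp only [← Finset.mul_sum, ← map_sum, sum_mul_antipode_eq_smul] at key
  simp only [map_mul, ← mul_assoc, ← Finset.sum_mul, sum_leftA_diag] at key
  rw [key]
  simp only [map_smul, map_one, mul_smul_comm, mul_one]
  conv_lhs => rw [← sum_right_counit_smul r]
  simp only [Finset.sum_smul, map_sum, smul_assoc, map_smul]

/-- `L(a) D(S(h)) = ∑ D(S(h₁)) L(h₂ • a)`. -/
theorem leftA_mul_diag_antipode {h : H} {ι : Type*} (r : Coalgebra.Repr k h ι) (a : A) :
    leftA k A H a * diag k A H (antipode k h) = ∑ i ∈ r.index,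
      diag k A H (antipode k (r.left i)) * leftA k A H (r.right i • a) := by
  -- In ∑ D(S(h₁)) D(h₂) L(a) D(S(h₃)), either S(h₁) h₂ collapses or the last three factors form
  -- L(h₂ • a) by `leftA_smul`.
  let F : H ⊗[k] (H ⊗[k] H) →ₗ[k] Module.End k (A ⊗[k] H) :=
    TensorProduct.lift ((LinearMap.mul k _).compl₁₂
      ((diag k A H).toLinearMap.comp (antipode k))
      (TensorProduct.lift ((LinearMap.mul k _).compl₁₂
        ((LinearMap.mulRight k (leftA k A H a)).comp (diag k A H).toLinearMap)
        ((diag k A H).toLinearMap.comp (antipode k)))))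
  have hF : ∀ x y z : H, F (x ⊗ₜ[k] (y ⊗ₜ[k] z)) = diag k A H (antipode k x) *
      (diag k A H y * leftA k A H a * diag k A H (antipode k z)) := fun _ _ _ => rfl
  have key := congrArg F (Coalgebra.sum_tmul_tmul_eq r
    (fun i => Coalgebra.Repr.arbitrary k (r.left i))
    (fun i => Coalgebra.Repr.arbitrary k (r.right i)))
  simp only [map_sum, hF, ← Finset.mul_sum, ← leftA_smul] at key
  rw [← key]
  simp only [← mul_assoc, ← Finset.sum_mul, ← map_mul, ← map_sum, sum_antipode_mul_eq_smul]
  conv_lhs => rw [← Coalgebra.sum_counit_smul r]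
  simp only [map_sum, map_smul, map_one, Finset.mul_sum, mul_smul_comm, smul_mul_assoc, one_mul]

/-- Averaging over `∑ S(t₁) ⊗ t₂` preserves commutation with the action of `A`. -/
theorem leftA_mul_sandwich {p : Module.End k (A ⊗[k] H)}
    (hp : ∀ a : A, leftA k A H a * p = p * leftA k A H a) (t : H) (a : A) :
    leftA k A H a * sandwich (diag k A H) p (antipodeComul k t) =
      sandwich (diag k A H) p (antipodeComul k t) * leftA k A H a := by
  let r := Coalgebra.Repr.arbitrary k t
  -- Both sides equal ∑ D(S(t₁)) p L(t₂ • a) D(t₃). No integral property of t enters.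
  let F : H ⊗[k] (H ⊗[k] H) →ₗ[k] Module.End k (A ⊗[k] H) :=
    TensorProduct.lift ((LinearMap.mul k _).compl₁₂
      ((LinearMap.mulRight k p).comp ((diag k A H).toLinearMap.comp (antipode k)))
      (TensorProduct.lift ((LinearMap.mul k _).compl₁₂
        ((leftA k A H).comp ((hopfAct k H A).toLinearMap.flip a)) (diag k A H).toLinearMap)))
  have hF : ∀ x y z : H, F (x ⊗ₜ[k] (y ⊗ₜ[k] z)) = diag k A H (antipode k x) * p *
      (leftA k A H (y • a) * diag k A H z) := fun _ _ _ => rfl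
  have key := congrArg F (Coalgebra.sum_tmul_tmul_eq r
    (fun i => Coalgebra.Repr.arbitrary k (r.left i))
    (fun i => Coalgebra.Repr.arbitrary k (r.right i)))
  simp only [map_sum, hF, ← Finset.mul_sum, sum_leftA_diag] at key
  rw [antipodeComul_eq r]
  simp only [map_sum, sandwich_tmul, Finset.mul_sum, Finset.sum_mul]
  simp only [mul_assoc] at key ⊢
  rw [← key]
  refine Finset.sum_congr rfl fun i _ => ?_
  rw [← mul_assoc, leftA_mul_diag_antipode (Coalgebra.Repr.arbitrary k (r.left i)),
    Finset.sum_mul]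
  refine Finset.sum_congr rfl fun j _ => ?_
  rw [mul_assoc, ← mul_assoc (leftA k A H _) p, hp, mul_assoc]

theorem leftA_mem (W : Submodule (SmashProduct k A H) (SmashProduct k A H)) (a : A)
    {x : A ⊗[k] H} (hx : x ∈ (W : Set (SmashProduct k A H))) :
    leftA k A H a x ∈ (W : Set (SmashProduct k A H)) := by
  have h : mulMap k A H (a ⊗ₜ[k] 1) x ∈ (W : Set (SmashProduct k A H)) :=
    W.smul_mem (tmul k a 1) hx
  rwa [mulMap_tmul, map_one, mul_one] at h

theorem diag_mem (W : Submodule (SmashProduct k A H) (SmashProduct k A H)) (h : H)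
    {x : A ⊗[k] H} (hx : x ∈ (W : Set (SmashProduct k A H))) :
    diag k A H h x ∈ (W : Set (SmashProduct k A H)) := by
  have h : mulMap k A H (1 ⊗ₜ[k] h) x ∈ (W : Set (SmashProduct k A H)) :=
    W.smul_mem (tmul k 1 h) hx
  rwa [mulMap_tmul, show leftA k A H 1 = 1 from by ext; simp [leftA_tmul], one_mul] at h

/-- The left `A`-module underlying a left ideal of `A # H`. -/
def restrictA (W : Submodule (SmashProduct k A H) (SmashProduct k A H)) :
    Submodule A (A ⊗[k] H) where
  carrier := (W : Set (SmashProduct k A H))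
  add_mem' := fun hx hy => W.add_mem hx hy
  zero_mem' := W.zero_mem
  smul_mem' := fun a _ hx => leftA_mem W a hx

/-- Maschke's theorem: a left ideal of `A # H` which is a direct summand over `A` is a direct summand
over `A # H`. -/
theorem exists_projection [IsSemisimpleRing H]
    (W : Submodule (SmashProduct k A H) (SmashProduct k A H)) (p : A ⊗[k] H →ₗ[A] A ⊗[k] H)
    (hpW : ∀ x, p x ∈ restrictA W) (hp : ∀ x ∈ restrictA W, p x = x) :
    ∃ q : SmashProduct k A H →ₗ[SmashProduct k A H] SmashProduct k A H,
      (∀ x, q x ∈ W) ∧ ∀ x ∈ W, q x = x := by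
  obtain ⟨t, ht, ht'⟩ := exists_right_integral k H
  let P : Module.End k (A ⊗[k] H) := p.restrictScalars k
  let r := Coalgebra.Repr.arbitrary k t
  let Q : Module.End k (A ⊗[k] H) := sandwich (diag k A H) P (antipodeComul k t)
  have hQ : ∀ x, Q x = ∑ i ∈ r.index,
      diag k A H (antipode k (r.left i)) (p (diag k A H (r.right i) x)) := fun x => by
    simp only [Q, antipodeComul_eq r, map_sum, LinearMap.sum_apply]
    rfl
  have hA : ∀ a, leftA k A H a * Q = Q * leftA k A H a :=
    leftA_mul_sandwich (fun a => LinearMap.ext fun x => (p.map_smul a x).symm) t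
  have hH : ∀ h, diag k A H h * Q = Q * diag k A H h := fun h => by
    rw [← sandwich_tmul_one_mul, tmul_one_mul_antipodeComul ht', sandwich_mul_one_tmul]
  have hB : ∀ x : A ⊗[k] H, mulMap k A H x * Q = Q * mulMap k A H x := fun x => by
    induction x using TensorProduct.induction_on with
    | zero => simp
    | tmul a h => rw [mulMap_tmul, mul_assoc, hH, ← mul_assoc, hA, mul_assoc]
    | add x y hx hy => rw [map_add, add_mul, hx, hy, mul_add]
  have hQW : ∀ x, Q x ∈ restrictA W := fun x => by
    rw [hQ]
    exact Submodule.sum_mem _ fun i _ => diag_mem W _ (hpW _)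
  have hQid : ∀ x ∈ restrictA W, Q x = x := fun x hx => by
    have h2 : ∀ i, p (diag k A H (r.right i) x) = diag k A H (r.right i) x :=
      fun i => hp _ (diag_mem W _ hx)
    rw [hQ]
    simp only [h2, ← Module.End.mul_apply, ← map_mul, ← LinearMap.sum_apply, ← map_sum,
      sum_antipode_mul_eq_smul, ht, one_smul, map_one, Module.End.one_apply]
  exact ⟨{ toFun := Q
           map_add' := Q.map_add
           map_smul' := fun x y => (LinearMap.congr_fun (hB x) y).symm }, hQW, hQid⟩

theorem isSemisimpleRing [IsSemisimpleRing H] [IsSemisimpleRing A] :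
    IsSemisimpleRing (SmashProduct k A H) := by
  refine (isSemisimpleModule_iff _ _).2 ⟨fun W => ?_⟩
  -- A ⊗ H is a semisimple A-module, so the identity of W extends to an A-linear retraction.
  obtain ⟨f, hf⟩ := IsSemisimpleModule.extension_property (restrictA W).subtype
    (restrictA W).injective_subtype LinearMap.id
  obtain ⟨q, hqW, hq⟩ := exists_projection W ((restrictA W).subtype.comp f)
    (fun x => (f x).2) (fun x hx => congrArg Subtype.val (LinearMap.congr_fun hf ⟨x, hx⟩))
  exact ⟨LinearMap.ker (q.codRestrict W hqW),
    LinearMap.isCompl_of_proj fun x => Subtype.ext (hq x x.2)⟩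

theorem isVonNeumannRegularRing [IsSemisimpleRing H] (hA : IsVonNeumannRegularRing A) :
    IsVonNeumannRegularRing (SmashProduct k A H) := fun b => by
  have := HopfAlgebra.finite_of_isSemisimpleRing k H
  let W := Submodule.span (SmashProduct k A H) {b}
  -- Right multiplication by b is A-linear with image W, so W is finitely generated over A.
  let φ : A ⊗[k] H →ₗ[A] A ⊗[k] H :=
    { toFun := fun x => mulMap k A H x b
      map_add' := fun x y => LinearMap.congr_fun (map_add (mulMap k A H) x y) b
      map_smul' := fun a x => LinearMap.congr_fun (mulMap_leftA a x) b }
  have hW : (restrictA W).FG := by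
    have : restrictA W = (⊤ : Submodule A (A ⊗[k] H)).map φ := by
      ext x
      rw [Submodule.map_top, LinearMap.mem_range]
      exact Submodule.mem_span_singleton (R := SmashProduct k A H) (M := SmashProduct k A H)
    rw [this]
    exact Module.Finite.fg_top.map φ
  obtain ⟨p, hpW, hp⟩ := (IsRegularModule.tensorProduct H hA).exists_projection hW
  obtain ⟨q, hqW, hq⟩ := exists_projection W p hpW hp
  -- Writing q(1) = y b gives b y b = b q(1) = q(b) = b.
  obtain ⟨y, hy⟩ := Submodule.mem_span_singleton.1 (hqW 1)
  refine ⟨y, ?_⟩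
  rw [mul_assoc, ← smul_eq_mul y, hy, ← smul_eq_mul b, ← map_smul, smul_eq_mul, mul_one]
  exact hq b (Submodule.mem_span_singleton_self b)

end SmashProduct

theorem mainTheorem3 (k H A : Type*) [Field k]
    [Ring H] [HopfAlgebra k H] [IsSemisimpleRing H]
    [Ring A] [Algebra k A] [Module H A] [IsScalarTower k H A] [HopfModuleAlgebra k H A] :
    (IsVonNeumannRegularRing A → IsVonNeumannRegularRing (SmashProduct k A H)) ∧
      (IsSemisimpleRing A → IsSemisimpleRing (SmashProduct k A H)) :=
  ⟨SmashProduct.isVonNeumannRegularRing, fun _ => SmashProduct.isSemisimpleRing⟩
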